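/- In the best-choice prophet secretary problem with the origins of the values revealed, one is given probability distributions $D_1,\dots,D_n$ on $\mathbb{R}$ with $n\ge 1$, known in advance. Values $x_i\sim D_i$ are drawn independently and are presented in a uniformly random order $\pi$ that is independent of the values. At step $k$ the algorithm sees $\pi_k$ and $x_{\pi_k}$ (so it learns which distribution produced the value) and must irrevocably choose this value, which ends the process, or pass. The algorithm may depend on $D_1,\dots,D_n$ and may use independent random numbers. It succeeds if it chooses a value and that value equals $\max_i x_i$. A single-threshold algorithm chooses the first value that is at least a fixed threshold $\tau$ (possibly breaking ties with $\tau$ at random: a value equal to $\tau$ is accepted if and only if a fresh uniform random number from $[0,1]$ is at least a fixed $\bar y$). The maximum $$M=\max_{\lambda\ge 0}\sum_{k=1}^{\infty}\frac1k\,\frac{\lambda^k e^{-\lambda}}{k!}$$ exists, and there is an absolute constant $\varepsilon_0>0$ such that for all $n\ge 1$ and all probability distributions $D_1,\dots,D_n$ on $\mathbb{R}$ (with no further assumption; atoms are allowed) there is an algorithm that succeeds with probability at least $M+\varepsilon_0$. Single-threshold algorithms are therefore not optimal in this model: for every $\delta>0$ there are $n\ge1$ and distributions $D_1,\dots,D_n$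 for which every single-threshold algorithm succeeds with probability less than $M+\delta$. -/

import Mathlib

open MeasureTheory

noncomputable section

namespace ProphetSecretary

/-- What is revealed at one step of a best-choice prophet secretary instance with `n` distributions:
the index of the distribution that produced the current value, the value itself, and a fresh
random number (uniform on `[0,1]`) that a rule may use for randomization and for breaking ties. -/
abbrev Obs (n : ℕ) : Type := Fin n × ℝ × ℝ

/-- An online algorithm for `n` values (it is chosen with the distributions known): for every
step `k`, the measurable set of histories of observations, up to and including step `k`, at which
it chooses the current value. Only the first such step counts, as the process stops there. -/
structure OnlineAlg (n : ℕ) where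
  accept : (k : Fin n) → Set (Fin ((k : ℕ) + 1) → Obs n)
  measurableSet_accept : ∀ k, MeasurableSet (accept k)

/-- The observations up to and including step `k`, when the values `x` arrive in the order
`x (π 0), x (π 1), …` and the random numbers of the successive steps are `y 0, y 1, …`. -/
def history {n : ℕ} (π : Equiv.Perm (Fin n)) (x y : Fin n → ℝ) (k : Fin n) :
    Fin ((k : ℕ) + 1) → Obs n :=
  fun j => (π (Fin.castLE k.isLt j), x (π (Fin.castLE k.isLt j)), y (Fin.castLE k.isLt j))

/-- The algorithm `A` stops at step `k`: it accepts at this step and at no earlier one. -/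
def OnlineAlg.StopsAt {n : ℕ} (A : OnlineAlg n) (π : Equiv.Perm (Fin n)) (x y : Fin n → ℝ)
    (k : Fin n) : Prop :=
  history π x y k ∈ A.accept k ∧ ∀ j < k, history π x y j ∉ A.accept j

/-- The algorithm `A` succeeds: it chooses some value, and that value equals the maximum. -/
def OnlineAlg.Succeeds {n : ℕ} (A : OnlineAlg n) (π : Equiv.Perm (Fin n)) (x y : Fin n → ℝ) :
    Prop :=
  ∃ k, A.StopsAt π x y k ∧ ∀ i, x i ≤ x (π k)

/-- The joint law of the values, which are independent with `x i` drawn from `D i`, and of the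
random numbers of the steps, which are independent, uniform on `[0,1]`, and independent of the
values. -/
def law {n : ℕ} (D : Fin n → Measure ℝ) : Measure ((Fin n → ℝ) × (Fin n → ℝ)) :=
  (Measure.pi D).prod (Measure.pi fun _ => volume.restrict (Set.Icc (0 : ℝ) 1))

/-- The probability that `A` chooses the maximum when the values are drawn independently from the
`D i` and are presented in a uniformly random order (independent of the values): the average, over
all permutations `π`, of the success probability for the order `π`. -/
def successProb {n : ℕ} (D : Fin n → Measure ℝ) (A : OnlineAlg n) : ℝ :=
  (∑ π : Equiv.Perm (Fin n), (law D).real {xy | A.Succeeds π xy.1 xy.2}) / (n.factorial : ℝ)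

/-- The single-threshold algorithm with threshold `τ` and secondary, tie-breaking threshold `ybar`:
choose the first value `v` with `v > τ`, or with `v = τ` and random number at least `ybar`.
For `ybar ≤ 0` this is the first value `≥ τ`, for `ybar > 1` (almost surely) the first `> τ`. -/
def singleThreshold (n : ℕ) (τ ybar : ℝ) : OnlineAlg n where
  accept k := {h | τ < (h (Fin.last k)).2.1 ∨
    ((h (Fin.last k)).2.1 = τ ∧ ybar ≤ (h (Fin.last k)).2.2)}
  measurableSet_accept k := by
    have h1 : Measurable fun h : Fin ((k : ℕ) + 1) → Obs n => (h (Fin.last k)).2.1 := by fun_prop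
    have h2 : Measurable fun h : Fin ((k : ℕ) + 1) → Obs n => (h (Fin.last k)).2.2 := by fun_prop
    exact (measurableSet_lt measurable_const h1).union
      ((measurableSet_eq_fun h1 measurable_const).inter (measurableSet_le measurable_const h2))

/-- The series `∑_{k ≥ 1} (1/k) * (lam^k * exp (-lam) / k!)` (the summation index is shifted by
one). -/
def poissonSum (lam : ℝ) : ℝ :=
  ∑' k : ℕ, 1 / ((k : ℝ) + 1) * (lam ^ (k + 1) * Real.exp (-lam) / ((k + 1).factorial : ℝ))

/-- The series that defines `poissonSum` converges. -/
theorem summable_poissonSum (lam : ℝ) :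
    Summable fun k : ℕ =>
      1 / ((k : ℝ) + 1) * (lam ^ (k + 1) * Real.exp (-lam) / ((k + 1).factorial : ℝ)) := by
  have h0 : Summable fun k : ℕ => |lam| ^ (k + 1) / ((k + 1).factorial : ℝ) :=
    (summable_nat_add_iff 1).2 (Real.summable_pow_div_factorial |lam|)
  refine Summable.of_norm_bounded (h0.mul_left (Real.exp (-lam))) fun k => ?_
  have hk : (1 : ℝ) / ((k : ℝ) + 1) ≤ 1 := by
    rw [div_le_one (by positivity)]
    linarith [(Nat.cast_nonneg k : (0 : ℝ) ≤ k)]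
  have hpos : (0 : ℝ) ≤ 1 / ((k : ℝ) + 1) := by positivity
  rw [Real.norm_eq_abs, abs_mul, abs_of_nonneg hpos, abs_div, abs_mul, abs_pow,
    abs_of_pos (Real.exp_pos _), abs_of_nonneg (Nat.cast_nonneg (α := ℝ) _)]
  have hB : (0 : ℝ) ≤ |lam| ^ (k + 1) * Real.exp (-lam) / ((k + 1).factorial : ℝ) := by positivity
  calc _ ≤ 1 * (|lam| ^ (k + 1) * Real.exp (-lam) / ((k + 1).factorial : ℝ)) :=
        mul_le_mul_of_nonneg_right hk hB
    _ = _ := by ring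

end ProphetSecretary

end

/-!
Attach the random number of a step to the item that arrives there. A threshold rule then selects a
random set `S` of items, containing the items independently and with a distribution that does not
depend on the arrival order, and it succeeds as soon as the maximum is the first of `S` to arrive.
Hence its success probability is at least the mean of `1 / #S`, with equality if there are no ties.
Integrating the generating function of `#S` and applying Bernoulli's inequality shows that this
mean is at least `poissonSum lam` if `S` is empty with probability `exp (-lam)`, and a randomized
threshold with this property exists.

Now lower the threshold during a final fraction `δ` of the steps. This gains order `δ`, from the
event that a single item lies between the two thresholds, none lies above, and that item arrives
late. Harm is only possible if the maximum and another item above the lower threshold both arrive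
late, which costs order `δ ^ 2`. So a small `δ`, depending only on `lam`, gives a uniform gain.

Conversely, for `n` identical distributions without atoms `S` has a binomial number of elements.
If each item belongs to `S` with probability `p`, the mean of `1 / #S` is close to
`poissonSum (n * p)` for small `p`, and is small if `n * p` is large.
-/

namespace ProphetSecretary

open Finset Filter Topology ProbabilityTheory
open scoped Nat

section Poisson

theorem poissonSum_pos {lam : ℝ} (h : 0 < lam) : 0 < poissonSum lam :=
  (summable_poissonSum lam).tsum_pos (fun k => by positivity) 0 (by positivity)

theorem poissonSum_nonneg {lam : ℝ} (h : 0 ≤ lam) : 0 ≤ poissonSum lam :=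
  tsum_nonneg fun k => by positivity

theorem poissonSum_le_two_div {lam : ℝ} (h : 0 < lam) : poissonSum lam ≤ 2 / lam := by
  have hexp : HasSum (fun k : ℕ => lam ^ k / (k ! : ℝ)) (Real.exp lam) := by
    simpa only [Real.exp_eq_exp_ℝ] using NormedSpace.expSeries_div_hasSum_exp lam
  have htail : ∑' k : ℕ, lam ^ (k + 2) / ((k + 2)! : ℝ) ≤ Real.exp lam :=
    hexp.tsum_eq ▸ tsum_comp_le_tsum_of_inj hexp.summable (fun k => by positivity)
      (add_left_injective 2)
  have hterm (k : ℕ) : 1 / ((k : ℝ) + 1) * (lam ^ (k + 1) * Real.exp (-lam) / ((k + 1)! : ℝ)) ≤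
      2 / lam * Real.exp (-lam) * (lam ^ (k + 2) / ((k + 2)! : ℝ)) := by
    have hk : 1 / ((k : ℝ) + 1) ≤ 2 / ((k : ℝ) + 2) := by
      rw [div_le_div_iff₀ (by positivity) (by positivity)]
      linarith [(Nat.cast_nonneg k : (0 : ℝ) ≤ k)]
    calc _ ≤ 2 / ((k : ℝ) + 2) * (lam ^ (k + 1) * Real.exp (-lam) / ((k + 1)! : ℝ)) := by gcongr
      _ = _ := by
        rw [Nat.factorial_succ (k + 1), pow_succ lam (k + 1)]
        push_cast
        field_simp
        ring
  calc poissonSum lam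
      ≤ ∑' k : ℕ, 2 / lam * Real.exp (-lam) * (lam ^ (k + 2) / ((k + 2)! : ℝ)) :=
        (summable_poissonSum lam).tsum_le_tsum hterm
          (((summable_nat_add_iff 2).2 hexp.summable).mul_left _)
    _ = 2 / lam * Real.exp (-lam) * ∑' k : ℕ, lam ^ (k + 2) / ((k + 2)! : ℝ) := tsum_mul_left
    _ ≤ 2 / lam * Real.exp (-lam) * Real.exp lam := by gcongr
    _ = 2 / lam := by rw [mul_assoc, ← Real.exp_add]; simp

theorem continuous_poissonSum : Continuous poissonSum := by
  refine continuous_iff_continuousAt.2 fun x => ?_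
  set R : ℝ := |x| + 1
  have hR : Set.Icc (-R) R ∈ 𝓝 x :=
    Icc_mem_nhds (by linarith [neg_abs_le x]) (by linarith [le_abs_self x])
  have hs : Summable fun k : ℕ => Real.exp R * (R ^ (k + 1) / ((k + 1)! : ℝ)) :=
    ((summable_nat_add_iff 1).2 (Real.summable_pow_div_factorial R)).mul_left _
  refine (continuousOn_tsum (fun k => by fun_prop) hs fun k y hy => ?_).continuousAt hR
  have hy' : |y| ≤ R := abs_le.2 hy
  have hk : 1 / ((k : ℝ) + 1) ≤ 1 :=
    (div_le_one (by positivity)).2 (by linarith [(Nat.cast_nonneg k : (0 : ℝ) ≤ k)])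
  rw [Real.norm_eq_abs, abs_mul, abs_of_nonneg (a := 1 / ((k : ℝ) + 1)) (by positivity), abs_div,
    abs_mul, abs_pow, Real.abs_exp, Nat.abs_cast]
  calc _ ≤ 1 * (R ^ (k + 1) * Real.exp R / ((k + 1)! : ℝ)) := by
        gcongr
        linarith [hy.1]
    _ = _ := by ring

theorem exists_isMaxOn_poissonSum : ∃ lam : ℝ, 0 < lam ∧ IsMaxOn poissonSum (Set.Ici 0) lam := by
  have h1 : 0 < poissonSum 1 := poissonSum_pos one_pos
  have hfar : ∀ᶠ x in cocompact ℝ ⊓ 𝓟 (Set.Ici 0), poissonSum x ≤ poissonSum 1 := by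
    rw [eventually_inf_principal]
    filter_upwards [(isCompact_Icc (a := 0) (b := 2 / poissonSum 1)).compl_mem_cocompact]
      with x hx hx0
    have hlt : 2 / poissonSum 1 < x := by simpa using fun h => hx ⟨hx0, h⟩
    have hx' : 0 < x := (by positivity : 0 < 2 / poissonSum 1).trans hlt
    exact (poissonSum_le_two_div hx').trans ((div_lt_comm₀ h1 hx').1 hlt).le
  obtain ⟨lam, hlam, hmax⟩ := continuous_poissonSum.continuousOn.exists_isMaxOn' isClosed_Ici
    (zero_le_one : (0 : ℝ) ≤ 1) hfar
  refine ⟨lam, lt_of_le_of_ne hlam ?_, hmax⟩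
  rintro rfl
  have h10 : poissonSum 1 ≤ poissonSum 0 := hmax (zero_le_one : (0 : ℝ) ≤ 1)
  have h0 : poissonSum 0 = 0 := by simp [poissonSum]
  linarith

end Poisson

section InclusionProb

variable {ι : Type*} [Fintype ι] [DecidableEq ι]

/-- The probability that the random set which contains each `i` independently with probability
`p i` is equal to `T`. -/
noncomputable def inclusionProb (p : ι → ℝ) (T : Finset ι) : ℝ :=
  (∏ i ∈ T, p i) * ∏ i ∈ Tᶜ, (1 - p i)

/-- The mean of `1 / #T` for the random set `T` which contains each `i` independently with
probability `p i`. The empty set contributes `0`, in accordance with `1 / 0 = 0`: it stands for the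
event that a threshold rule accepts nothing. -/
noncomputable def meanInvCard (p : ι → ℝ) : ℝ :=
  ∑ T : Finset ι, inclusionProb p T * (1 / (#T : ℝ))

theorem inclusionProb_nonneg {p : ι → ℝ} (h0 : ∀ i, 0 ≤ p i) (h1 : ∀ i, p i ≤ 1) (T : Finset ι) :
    0 ≤ inclusionProb p T :=
  mul_nonneg (prod_nonneg fun i _ => h0 i) (prod_nonneg fun i _ => sub_nonneg.2 (h1 i))

theorem sum_inclusionProb_mul_pow_card (p : ι → ℝ) (s : ℝ) :
    ∑ T, inclusionProb p T * s ^ #T = ∏ i, (p i * s + (1 - p i)) := by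
  rw [Fintype.prod_add]
  refine sum_congr rfl fun T _ => ?_
  rw [inclusionProb, prod_mul_distrib, prod_const]
  ring

end InclusionProb

section IntegralRepresentation

theorem intervalIntegrable_sub_zero_div {f : ℝ → ℝ} (hf : Differentiable ℝ f) (a b : ℝ) :
    IntervalIntegrable (fun s => (f s - f 0) / s) volume a b := by
  have hcont : Continuous (dslope f 0) :=
    continuousOn_univ.1 ((continuousOn_dslope univ_mem).2 ⟨hf.continuous.continuousOn, hf 0⟩)
  refine (hcont.intervalIntegrable a b).congr_ae (ae_restrict_of_ae ?_)
  filter_upwards [Measure.ae_ne volume 0] with s hs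
  rw [dslope_of_ne _ hs, slope_def_field, sub_zero]

/-- The term `0 ^ k` makes this hold for `k = 0` too, where both sides are `0`. -/
theorem integral_pow_sub_zero_pow_div (k : ℕ) :
    ∫ s in (0 : ℝ)..1, (s ^ k - 0 ^ k) / s = 1 / k := by
  cases k with
  | zero => simp
  | succ k =>
    calc ∫ s in (0 : ℝ)..1, (s ^ (k + 1) - 0 ^ (k + 1)) / s = ∫ s in (0 : ℝ)..1, s ^ k := by
          refine intervalIntegral.integral_congr_uIoo fun s hs => ?_
          rw [Set.uIoo_of_le zero_le_one] at hs
          have := hs.1.ne'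
          simp only [zero_pow k.succ_ne_zero, sub_zero]
          field_simp
          ring
      _ = 1 / (k + 1 : ℕ) := by rw [integral_pow]; simp

variable {ι : Type*} [Fintype ι]

theorem intervalIntegrable_prod_sub_prod_div (p : ι → ℝ) (a b : ℝ) :
    IntervalIntegrable (fun s => (∏ i, (p i * s + (1 - p i)) - ∏ i, (1 - p i)) / s) volume a b := by
  simpa using intervalIntegrable_sub_zero_div (f := fun s => ∏ i, (p i * s + (1 - p i)))
    (by fun_prop) a b

theorem meanInvCard_eq_integral [DecidableEq ι] (p : ι → ℝ) :
    meanInvCard p = ∫ s in (0 : ℝ)..1, (∏ i, (p i * s + (1 - p i)) - ∏ i, (1 - p i)) / s := by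
  have hint (T : Finset ι) : IntervalIntegrable
      (fun s : ℝ => inclusionProb p T * ((s ^ #T - 0 ^ #T) / s)) volume 0 1 :=
    (intervalIntegrable_sub_zero_div (f := fun s => s ^ #T) (by fun_prop) 0 1).const_mul _
  have hG (s : ℝ) : ∑ T, inclusionProb p T * ((s ^ #T - 0 ^ #T) / s) =
      (∏ i, (p i * s + (1 - p i)) - ∏ i, (1 - p i)) / s := by
    have h0 := sum_inclusionProb_mul_pow_card p 0
    simp only [mul_zero, zero_add] at h0
    rw [← h0, ← sum_inclusionProb_mul_pow_card, ← sum_sub_distrib, sum_div]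
    exact sum_congr rfl fun T _ => by ring
  simp only [← hG]
  rw [intervalIntegral.integral_finsetSum fun T _ => hint T, meanInvCard]
  simp only [intervalIntegral.integral_const_mul, integral_pow_sub_zero_pow_div]

theorem intervalIntegrable_exp_sub_exp_div (lam a b : ℝ) :
    IntervalIntegrable (fun s => (Real.exp (-lam) * Real.exp (lam * s) - Real.exp (-lam)) / s)
      volume a b := by
  simpa using intervalIntegrable_sub_zero_div
    (f := fun s => Real.exp (-lam) * Real.exp (lam * s)) (by fun_prop) a b

theorem poissonSum_eq_integral (lam : ℝ) :
    poissonSum lam =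
      ∫ s in (0 : ℝ)..1, (Real.exp (-lam) * Real.exp (lam * s) - Real.exp (-lam)) / s := by
  set a : ℕ → ℝ := fun k => lam ^ (k + 1) * Real.exp (-lam) / ((k + 1)! : ℝ) with ha
  have hpow (k : ℕ) (c : ℝ) : ∫ s in Set.Ioc (0 : ℝ) 1, c * s ^ k = 1 / ((k : ℝ) + 1) * c := by
    rw [← intervalIntegral.integral_of_le zero_le_one, intervalIntegral.integral_const_mul,
      integral_pow]
    simp [mul_comm]
  have hnorm (k : ℕ) : ∫ s in Set.Ioc (0 : ℝ) 1, ‖a k * s ^ k‖ = ‖1 / ((k : ℝ) + 1) * a k‖ := by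
    rw [norm_mul, Real.norm_of_nonneg (by positivity), ← hpow]
    refine setIntegral_congr_fun measurableSet_Ioc fun s hs => ?_
    have := hs.1.le
    rw [norm_mul, Real.norm_of_nonneg (by positivity : 0 ≤ s ^ k)]
  have hsum := hasSum_integral_of_summable_integral_norm (F := fun k s => a k * s ^ k)
    (μ := volume.restrict (Set.Ioc (0 : ℝ) 1))
    (fun k => (Continuous.integrableOn_Ioc (by fun_prop)))
    (by simpa only [hnorm] using (summable_poissonSum lam).norm)
  simp only [hpow] at hsum
  rw [poissonSum, hsum.tsum_eq, intervalIntegral.integral_of_le zero_le_one]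
  refine setIntegral_congr_fun measurableSet_Ioc fun s hs => ?_
  have hs0 : s ≠ 0 := hs.1.ne'
  have hexp : HasSum (fun k : ℕ => (lam * s) ^ k / (k ! : ℝ)) (Real.exp (lam * s)) := by
    simpa only [Real.exp_eq_exp_ℝ] using NormedSpace.expSeries_div_hasSum_exp (lam * s)
  have htail := (((hasSum_nat_add_iff' 1).2 hexp).mul_left (Real.exp (-lam))).div_const s
  simp only [range_one, sum_singleton, pow_zero, Nat.factorial_zero, Nat.cast_one, div_one,
    mul_sub, mul_one] at htail
  rw [← htail.tsum_eq]
  refine tsum_congr fun k => ?_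
  simp only [ha]
  field_simp
  ring

end IntegralRepresentation

section Comparison

variable {ι : Type*} [Fintype ι] [DecidableEq ι] {p : ι → ℝ}

theorem poissonSum_le_meanInvCard (h1 : ∀ i, p i ≤ 1) {lam : ℝ}
    (hlam : ∏ i, (1 - p i) = Real.exp (-lam)) : poissonSum lam ≤ meanInvCard p := by
  rw [poissonSum_eq_integral, meanInvCard_eq_integral]
  refine intervalIntegral.integral_mono_on_of_le_Ioo zero_le_one
    (intervalIntegrable_exp_sub_exp_div lam 0 1) (intervalIntegrable_prod_sub_prod_div p 0 1)
    fun s hs => ?_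
  have hfactor (i : ι) : (1 - p i) ^ (1 - s) ≤ p i * s + (1 - p i) := by
    have := rpow_one_add_le_one_add_mul_self (s := -p i) (p := 1 - s) (by linarith [h1 i])
      (by linarith [hs.2]) (by linarith [hs.1])
    rw [← sub_eq_add_neg] at this
    linarith
  have hbernoulli : Real.exp (-lam) * Real.exp (lam * s) ≤ ∏ i, (p i * s + (1 - p i)) :=
    calc Real.exp (-lam) * Real.exp (lam * s) = (∏ i, (1 - p i)) ^ (1 - s) := by
          rw [hlam, ← Real.exp_mul, ← Real.exp_add]
          ring_nf
      _ = ∏ i, (1 - p i) ^ (1 - s) :=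
          (Real.finsetProd_rpow _ _ (fun i _ => sub_nonneg.2 (h1 i)) _).symm
      _ ≤ ∏ i, (p i * s + (1 - p i)) :=
          prod_le_prod (fun i _ => Real.rpow_nonneg (sub_nonneg.2 (h1 i)) _) fun i _ => hfactor i
  rw [hlam]
  have := hs.1.le
  gcongr

theorem meanInvCard_le_mul_poissonSum (h0 : ∀ i, 0 ≤ p i) (h1 : ∀ i, p i < 1) :
    meanInvCard p ≤ (∏ i, (1 - p i)) * Real.exp (∑ i, p i / (1 - p i)) *
      poissonSum (∑ i, p i / (1 - p i)) := by
  set r : ℝ := ∑ i, p i / (1 - p i)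
  have hpos (i : ι) : 0 < 1 - p i := sub_pos.2 (h1 i)
  rw [poissonSum_eq_integral, meanInvCard_eq_integral, ← intervalIntegral.integral_const_mul]
  refine intervalIntegral.integral_mono_on_of_le_Ioo zero_le_one
    (intervalIntegrable_prod_sub_prod_div p 0 1)
    ((intervalIntegrable_exp_sub_exp_div r 0 1).const_mul _) fun s hs => ?_
  have hodds : ∏ i, (p i * s + (1 - p i)) ≤ (∏ i, (1 - p i)) * Real.exp (r * s) :=
    calc ∏ i, (p i * s + (1 - p i)) = (∏ i, (1 - p i)) * ∏ i, (p i / (1 - p i) * s + 1) := by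
          rw [← prod_mul_distrib]
          refine prod_congr rfl fun i _ => ?_
          have := (hpos i).ne'
          field_simp
      _ ≤ (∏ i, (1 - p i)) * ∏ i, Real.exp (p i / (1 - p i) * s) := by
          refine mul_le_mul_of_nonneg_left (prod_le_prod (fun i _ => ?_)
            fun i _ => Real.add_one_le_exp _) (prod_nonneg fun i _ => (hpos i).le)
          have := mul_nonneg (div_nonneg (h0 i) (hpos i).le) hs.1.le
          positivity
      _ = (∏ i, (1 - p i)) * Real.exp (r * s) := by rw [← Real.exp_sum, ← sum_mul]
  calc (∏ i, (p i * s + (1 - p i)) - ∏ i, (1 - p i)) / s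
      ≤ ((∏ i, (1 - p i)) * Real.exp (r * s) - ∏ i, (1 - p i)) / s := by
        have := hs.1.le
        gcongr
    _ = _ := by
        rw [Real.exp_neg]
        field_simp

theorem meanInvCard_le_two_div_sum (h0 : ∀ i, 0 ≤ p i) (h1 : ∀ i, p i ≤ 1) (hsum : 0 < ∑ i, p i) :
    meanInvCard p ≤ 2 / ∑ i, p i := by
  set c : ℝ := ∑ i, p i with hc
  have hinv (k : ℕ) : 1 / (k : ℝ) ≤ 2 * ∫ s in (0 : ℝ)..1, s ^ k := by
    rw [integral_pow, one_pow, zero_pow k.succ_ne_zero, sub_zero, mul_one_div]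
    rcases k.eq_zero_or_pos with rfl | hk
    · simp
    · have : (1 : ℝ) ≤ k := mod_cast hk
      rw [div_le_div_iff₀ (by positivity) (by positivity)]
      linarith
  have hexp (s : ℝ) (hs : s ∈ Set.Icc (0 : ℝ) 1) :
      ∏ i, (p i * s + (1 - p i)) ≤ Real.exp (c * (s - 1)) := by
    rw [hc, sum_mul, Real.exp_sum]
    refine prod_le_prod (fun i _ => ?_) fun i _ => ?_
    · exact add_nonneg (mul_nonneg (h0 i) hs.1) (sub_nonneg.2 (h1 i))
    · linarith [Real.add_one_le_exp (p i * (s - 1))]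
  calc meanInvCard p ≤ ∑ T, inclusionProb p T * (2 * ∫ s in (0 : ℝ)..1, s ^ #T) :=
        sum_le_sum fun T _ => mul_le_mul_of_nonneg_left (hinv _) (inclusionProb_nonneg h0 h1 T)
    _ = 2 * ∫ s in (0 : ℝ)..1, ∏ i, (p i * s + (1 - p i)) := by
        simp only [← sum_inclusionProb_mul_pow_card]
        rw [intervalIntegral.integral_finsetSum fun T _ => Continuous.intervalIntegrable
          (by fun_prop) 0 1, mul_sum]
        simp only [intervalIntegral.integral_const_mul, mul_left_comm]
    _ ≤ 2 * ∫ s in (0 : ℝ)..1, Real.exp (c * (s - 1)) := by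
        gcongr
        exact intervalIntegral.integral_mono_on zero_le_one
          (Continuous.intervalIntegrable (by fun_prop) 0 1)
          (Continuous.intervalIntegrable (by fun_prop) 0 1) hexp
    _ = 2 * ((1 - Real.exp (-c)) / c) := by
        have := intervalIntegral.integral_comp_mul_sub (a := 0) (b := 1) Real.exp hsum.ne' c
        simp only [mul_sub, mul_one, this, integral_exp, smul_eq_mul]
        simp
        ring
    _ ≤ 2 * (1 / c) := by
        gcongr
        linarith [Real.exp_pos (-c)]
    _ = 2 / c := by ring

theorem meanInvCard_const_le (n : ℕ) {p : ℝ} (h0 : 0 ≤ p) (h1 : p < 1) :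
    meanInvCard (fun _ : Fin n => p) ≤
      Real.exp (n * p * (p / (1 - p))) * poissonSum (n * (p / (1 - p))) := by
  have hp : 0 < 1 - p := sub_pos.2 h1
  have hodds := meanInvCard_le_mul_poissonSum (ι := Fin n) (fun _ => h0) fun _ => h1
  simp only [sum_const, prod_const, card_univ, Fintype.card_fin, nsmul_eq_mul] at hodds
  refine hodds.trans (mul_le_mul_of_nonneg_right ?_ (poissonSum_nonneg (by positivity)))
  calc (1 - p) ^ n * Real.exp (n * (p / (1 - p)))
      ≤ Real.exp (-p) ^ n * Real.exp (n * (p / (1 - p))) := by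
        gcongr
        exact Real.one_sub_le_exp_neg p
    _ = Real.exp (n * p * (p / (1 - p))) := by
        rw [← Real.exp_nat_mul, ← Real.exp_add]
        congr 1
        field_simp
        ring

theorem exists_meanInvCard_const_lt {M δ : ℝ} (hM0 : 0 < M)
    (hM : ∀ x, 0 ≤ x → poissonSum x ≤ M) (hδ : 0 < δ) :
    ∃ n : ℕ, 1 ≤ n ∧ ∀ p : ℝ, 0 ≤ p → p ≤ 1 → meanInvCard (fun _ : Fin n => p) < M + δ := by
  have hq : Tendsto (fun n : ℕ => 2 / M / n) atTop (𝓝 0) := tendsto_const_div_atTop_nhds_zero_nat _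
  have hlim : Tendsto (fun n : ℕ => Real.exp (2 / M * (2 / M / n / (1 - 2 / M / n))) * M) atTop
      (𝓝 M) := by
    have hcont : ContinuousAt (fun q : ℝ => Real.exp (2 / M * (q / (1 - q))) * M) 0 := by
      have : (1 : ℝ) - 0 ≠ 0 := by norm_num
      fun_prop (disch := assumption)
    simpa [Function.comp_def] using hcont.tendsto.comp hq
  obtain ⟨n, hn, hq1, hnM⟩ := ((eventually_ge_atTop 1).and <|
    (hq.eventually_lt_const one_pos).and
      (hlim.eventually_lt_const (lt_add_of_pos_right M hδ))).exists
  have hn0 : (0 : ℝ) < n := mod_cast hn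
  refine ⟨n, hn, fun p hp0 hp1 => ?_⟩
  rcases le_or_gt (2 / M) (n * p) with hnp | hnp
  · have hnp0 : 0 < n * p := lt_of_lt_of_le (by positivity) hnp
    have hmany := meanInvCard_le_two_div_sum (ι := Fin n) (fun _ => hp0) (fun _ => hp1)
      (by simpa using hnp0)
    simp only [sum_const, card_univ, Fintype.card_fin, nsmul_eq_mul] at hmany
    linarith [(div_le_comm₀ hM0 hnp0).1 hnp]
  · have hpq : p ≤ 2 / M / n := ((lt_div_iff₀' hn0).2 hnp).le
    have hp : p < 1 := hpq.trans_lt hq1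
    have : 0 < 1 - p := sub_pos.2 hp
    have : 0 < 1 - 2 / M / n := sub_pos.2 hq1
    calc meanInvCard (fun _ : Fin n => p)
        ≤ Real.exp (n * p * (p / (1 - p))) * poissonSum (n * (p / (1 - p))) :=
          meanInvCard_const_le n hp0 hp
      _ ≤ Real.exp (2 / M * (2 / M / n / (1 - 2 / M / n))) * M := by
          gcongr
          · exact poissonSum_nonneg (by positivity)
          · exact hM _ (by positivity)
      _ < M + δ := hnM

end Comparison

section Proportion

variable {α β : Type*} [Fintype α]

open scoped Classical in
/-- The proportion of the elements of a finite type that satisfy `P`: the probability of `P` for a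
uniformly random element. -/
noncomputable def proportion (P : α → Prop) : ℝ :=
  #{a | P a} / Fintype.card α

theorem proportion_nonneg (P : α → Prop) : 0 ≤ proportion P := by
  unfold proportion
  positivity

theorem proportion_true [Nonempty α] : proportion (fun _ : α => True) = 1 := by
  simp [proportion]

theorem proportion_mono {P Q : α → Prop} (h : ∀ a, P a → Q a) : proportion P ≤ proportion Q := by
  unfold proportion
  gcongr with a
  exact h a

open scoped Classical in
theorem proportion_comp_equiv [Fintype β] (e : α ≃ β) (P : β → Prop) :
    proportion (fun a => P (e a)) = proportion P := by
  have hcard : #{a | P (e a)} = #{b | P b} := card_equiv e (by simp)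
  rw [proportion, proportion, Fintype.card_congr e, hcard]

theorem proportion_le_add_sum {P Q : α → Prop} {s : Finset β} {R : β → α → Prop}
    (h : ∀ a, P a → Q a ∨ ∃ b ∈ s, R b a) :
    proportion P ≤ proportion Q + ∑ b ∈ s, proportion (R b) := by
  classical
  have hsub : ({a | P a} : Finset α) ⊆
      ({a | Q a} : Finset α) ∪ s.biUnion fun b => {a | R b a} := fun a ha => by
    simpa using h a (by simpa using ha)
  have hcard : #{a | P a} ≤ #{a | Q a} + ∑ b ∈ s, #{a | R b a} :=
    ((card_le_card hsub).trans (card_union_le _ _)).trans (by gcongr; exact card_biUnion_le)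
  simp only [proportion, ← sum_div, ← add_div]
  gcongr
  exact_mod_cast hcard

open scoped Classical in
theorem sum_proportion_eq_mul {Q : α → Prop} {s : Finset β} {R : β → α → Prop} {c : ℝ}
    (h : ∀ a, (#{b ∈ s | R b a} : ℝ) = if Q a then c else 0) :
    ∑ b ∈ s, proportion (R b) = c * proportion Q := by
  have hcount : ∑ b ∈ s, (#{a | R b a} : ℝ) = c * #{a | Q a} := by
    calc ∑ b ∈ s, (#{a | R b a} : ℝ) = ∑ a, (#{b ∈ s | R b a} : ℝ) :=
          mod_cast sum_card_bipartiteAbove_eq_sum_card_bipartiteBelow (s := s) (t := univ) R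
      _ = c * #{a | Q a} := by
          simp only [h, ← sum_filter, sum_const, nsmul_eq_mul, mul_comm]
  simp only [proportion, ← sum_div, hcount, mul_div_assoc]

end Proportion

section RandomOrder

theorem symm_swap_mul_apply {α : Type*} [DecidableEq α] (a b j : α) (π : Equiv.Perm α) :
    (Equiv.swap a b * π).symm j = π.symm (Equiv.swap a b j) := by
  simp [Equiv.symm_apply_eq]

theorem proportion_forall_mem_symm_le {α : Type*} [Fintype α] [LinearOrder α] {S : Finset α} {i : α}
    (hi : i ∈ S) :
    proportion (fun π : Equiv.Perm α => ∀ j ∈ S, π.symm i ≤ π.symm j) = 1 / (#S : ℝ) := by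
  classical
  have hsymm : ∀ a ∈ S, proportion (fun π : Equiv.Perm α => ∀ j ∈ S, π.symm a ≤ π.symm j) =
      proportion fun π : Equiv.Perm α => ∀ j ∈ S, π.symm i ≤ π.symm j := fun a ha => by
    rw [← proportion_comp_equiv (Equiv.mulLeft (Equiv.swap a i))
      fun π : Equiv.Perm α => ∀ j ∈ S, π.symm i ≤ π.symm j]
    have hS (j : α) : Equiv.swap a i j ∈ S ↔ j ∈ S := by
      rw [Equiv.swap_apply_def]
      split_ifs <;> simp_all
    simp only [Equiv.coe_mulLeft, symm_swap_mul_apply, Equiv.swap_apply_right]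
    congr! 2 with π
    rw [← (Equiv.swap a i).forall_congr_right]
    simp only [hS]
  have hunique (π : Equiv.Perm α) :
      (#{a ∈ S | ∀ j ∈ S, π.symm a ≤ π.symm j} : ℝ) = 1 := by
    obtain ⟨a, ha, hmin⟩ := S.exists_min_image π.symm ⟨i, hi⟩
    rw [Nat.cast_eq_one, card_eq_one]
    refine ⟨a, ext fun b => ?_⟩
    simp only [mem_filter, mem_singleton]
    refine ⟨fun hb => π.symm.injective (le_antisymm (hb.2 a ha) (hmin b hb.1)), ?_⟩
    rintro rfl
    exact ⟨ha, hmin⟩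
  have hsum := sum_proportion_eq_mul (s := S)
    (R := fun a (π : Equiv.Perm α) => ∀ j ∈ S, π.symm a ≤ π.symm j) (Q := fun _ => True)
    fun π => by
      rw [if_pos trivial]
      convert hunique π
  rw [sum_congr rfl hsymm, sum_const, nsmul_eq_mul, proportion_true, mul_one] at hsum
  exact eq_one_div_of_mul_eq_one_right hsum

variable {n m : ℕ}

/-- In the order `π`, the item `i` arrives in one of the last `m` steps. -/
def ArrivesLate (m : ℕ) (i : Fin n) (π : Equiv.Perm (Fin n)) : Prop :=
  n ≤ (π.symm i : ℕ) + m

open scoped Classical in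
theorem card_arrivesLate (h : m ≤ n) (π : Equiv.Perm (Fin n)) : #{i | ArrivesLate m i π} = m := by
  calc #{i | ArrivesLate m i π} = #{k : Fin n | (k : ℕ) < m} :=
        card_equiv (π.symm.trans Fin.revPerm) fun i => by
          rw [mem_filter_univ, mem_filter_univ, ArrivesLate, Equiv.trans_apply,
            Fin.revPerm_apply, Fin.val_rev]
          have := (π.symm i).isLt
          omega
    _ = m := by rw [Fin.card_filter_val_lt, min_eq_right h]

theorem arrivesLate_swap_mul {a i j : Fin n} {π : Equiv.Perm (Fin n)} :
    ArrivesLate m j (Equiv.swap a i * π) ↔ ArrivesLate m (Equiv.swap a i j) π := by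
  rw [ArrivesLate, ArrivesLate, symm_swap_mul_apply]

theorem proportion_arrivesLate (h : m ≤ n) (i : Fin n) :
    proportion (ArrivesLate m i) = (m : ℝ) / n := by
  classical
  have hsymm (a : Fin n) : proportion (ArrivesLate m a) = proportion (ArrivesLate m i) := by
    rw [← proportion_comp_equiv (Equiv.mulLeft (Equiv.swap a i)) (ArrivesLate m i)]
    simp only [Equiv.coe_mulLeft, arrivesLate_swap_mul, Equiv.swap_apply_right]
  have hsum := sum_proportion_eq_mul (s := univ) (R := ArrivesLate (n := n) m) (Q := fun _ => True)
    (c := m) fun π => by simp [card_arrivesLate h]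
  have hn : (n : ℝ) ≠ 0 := mod_cast i.pos.ne'
  rw [sum_congr rfl fun a _ => hsymm a, sum_const, nsmul_eq_mul, proportion_true, card_univ,
    Fintype.card_fin, mul_one] at hsum
  rw [← hsum, mul_div_cancel_left₀ _ hn]

theorem proportion_arrivesLate_and (h : m ≤ n) {i j : Fin n} (hij : i ≠ j) :
    proportion (fun π => ArrivesLate m i π ∧ ArrivesLate m j π) =
      (m : ℝ) / n * ((m - 1) / (n - 1)) := by
  classical
  have hsymm : ∀ a ∈ univ.erase i, proportion (fun π => ArrivesLate m i π ∧ ArrivesLate m a π) =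
      proportion fun π => ArrivesLate m i π ∧ ArrivesLate m j π := fun a ha => by
    rw [← proportion_comp_equiv (Equiv.mulLeft (Equiv.swap a j))
      fun π => ArrivesLate m i π ∧ ArrivesLate m j π]
    simp only [Equiv.coe_mulLeft, arrivesLate_swap_mul, Equiv.swap_apply_right,
      Equiv.swap_apply_of_ne_of_ne (ne_of_mem_erase ha).symm hij]
  have hsum := sum_proportion_eq_mul (s := univ.erase i) (Q := ArrivesLate m i) (c := m - 1)
    (R := fun a π => ArrivesLate m i π ∧ ArrivesLate m a π) fun π => by
      split_ifs with hi
      · simp only [hi, true_and, filter_erase]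
        rw [cast_card_erase_of_mem (by simpa using hi), card_arrivesLate h]
      · simp [hi]
  rw [sum_congr rfl hsymm, sum_const, nsmul_eq_mul, proportion_arrivesLate h,
    cast_card_erase_of_mem (mem_univ i), card_univ, Fintype.card_fin] at hsum
  have hn : (n : ℝ) - 1 ≠ 0 := by
    have := Fin.val_ne_of_ne hij
    exact sub_ne_zero.2 (by norm_cast; omega)
  rw [← mul_div_cancel_left₀ (proportion _) hn, hsum]
  ring

end RandomOrder

section SwitchSucceeds

variable {n m : ℕ} {S S' : Finset (Fin n)} {x : Fin n → ℝ} {i : Fin n}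

/-- The deterministic core of a rule that lowers its threshold for the last `m` steps: when `S` and
`S'` are the sets of the items above the high and the low threshold, the first arrival `π k` which
lies in the set in force at step `k` exists and maximizes `x`. -/
def SwitchSucceeds (m : ℕ) (S S' : Finset (Fin n)) (x : Fin n → ℝ) (π : Equiv.Perm (Fin n)) :
    Prop :=
  ∃ k : Fin n, (π k ∈ (if (k : ℕ) + m < n then S else S') ∧
    ∀ j < k, π j ∉ (if (j : ℕ) + m < n then S else S')) ∧ ∀ i, x i ≤ x (π k)

theorem switchSucceeds_of_forall_mem_le (hSS : S ⊆ S') (hi : i ∈ S) (hmax : ∀ j, x j ≤ x i)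
    {π : Equiv.Perm (Fin n)} (hfirst : ∀ j ∈ S, π.symm i ≤ π.symm j)
    (hlate : ∀ j ∈ S'.erase i, ¬(ArrivesLate m i π ∧ ArrivesLate m j π)) :
    SwitchSucceeds m S S' x π := by
  refine ⟨π.symm i, ⟨?_, fun j hj hmem => ?_⟩, by simpa using hmax⟩
  · rw [Equiv.apply_symm_apply]
    split_ifs
    exacts [hi, hSS hi]
  · have hjS : π j ∉ S := fun h => hj.not_ge (by simpa using hfirst _ h)
    split_ifs at hmem with hearly
    · exact hjS hmem
    · have hji : π j ≠ i := fun h => hjS (h ▸ hi)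
      refine hlate (π j) (mem_erase.2 ⟨hji, hmem⟩) ?_
      rw [ArrivesLate, ArrivesLate, Equiv.symm_apply_apply]
      rw [Fin.lt_def] at hj
      omega

theorem bothLate_nonneg (h : m ≤ n) : (0 : ℝ) ≤ m / n * ((m - 1) / (n - 1)) := by
  rcases m.eq_zero_or_pos with rfl | hm
  · simp
  · have hm1 : (1 : ℝ) ≤ m := mod_cast hm
    have hn1 : (1 : ℝ) ≤ n := mod_cast hm.trans_le h
    exact mul_nonneg (by positivity) (div_nonneg (sub_nonneg.2 hm1) (sub_nonneg.2 hn1))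

theorem sub_le_proportion_switchSucceeds (hm : m ≤ n) (hSS : S ⊆ S')
    (hS : ∀ i ∈ S, ∀ j ∉ S, x j ≤ x i) :
    1 / (#S : ℝ) - m / n * ((m - 1) / (n - 1)) * #S' ≤ proportion (SwitchSucceeds m S S' x) := by
  have hq := bothLate_nonneg hm
  rcases S.eq_empty_or_nonempty with rfl | hne
  · have := proportion_nonneg (SwitchSucceeds m ∅ S' x)
    have : 0 ≤ (m : ℝ) / n * ((m - 1) / (n - 1)) * #S' := by positivity
    simp only [card_empty, Nat.cast_zero, div_zero]
    linarith
  obtain ⟨i, hi, hmaxS⟩ := S.exists_max_image x hne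
  have hmax (j : Fin n) : x j ≤ x i := by
    by_cases hj : j ∈ S
    exacts [hmaxS j hj, hS i hi j hj]
  have hunion := proportion_le_add_sum (P := fun π => ∀ j ∈ S, π.symm i ≤ π.symm j)
    (Q := SwitchSucceeds m S S' x) (s := S'.erase i)
    (R := fun j π => ArrivesLate m i π ∧ ArrivesLate m j π) fun π hfirst => by
      by_contra! hcon
      refine hcon.1 (switchSucceeds_of_forall_mem_le hSS hi hmax hfirst fun j hj hlate => ?_)
      exact hcon.2 j hj hlate.1 hlate.2
  rw [proportion_forall_mem_symm_le hi, sum_congr rfl fun j hj =>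
    proportion_arrivesLate_and hm (ne_of_mem_erase hj).symm, sum_const, nsmul_eq_mul] at hunion
  have hcard : (#(S'.erase i) : ℝ) ≤ #S' := mod_cast card_le_card (erase_subset i S')
  linarith [mul_le_mul_of_nonneg_right hcard hq]

theorem div_le_proportion_switchSucceeds_singleton (hm : m ≤ n) (hx : ∀ j, x j ≤ x i) :
    (m : ℝ) / n ≤ proportion (SwitchSucceeds m ∅ {i} x) := by
  rw [← proportion_arrivesLate hm i]
  refine proportion_mono fun π hlate => ⟨π.symm i, ⟨?_, fun j hj hmem => ?_⟩, by simpa using hx⟩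
  · rw [if_neg hlate.not_gt]
    simp
  · split_ifs at hmem
    · simp at hmem
    · rw [← mem_singleton.1 hmem, Equiv.symm_apply_apply] at hj
      exact hj.false

theorem proportion_switchSucceeds_zero_le (hx : Function.Injective x) :
    proportion (SwitchSucceeds 0 S S' x) ≤ 1 / (#S : ℝ) := by
  by_cases hexists : ∃ π, SwitchSucceeds 0 S S' x π
  · obtain ⟨π₀, k₀, ⟨hk₀, -⟩, hmax₀⟩ := hexists
    rw [if_pos (by simp)] at hk₀
    rw [← proportion_forall_mem_symm_le hk₀]
    refine proportion_mono fun π hπ j hj => ?_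
    obtain ⟨k, ⟨-, hfirst⟩, hmax⟩ := hπ
    have hk : π k = π₀ k₀ := hx (le_antisymm (hmax₀ _) (hmax _))
    rw [← hk, Equiv.symm_apply_apply]
    by_contra! hlt
    have hj' := hfirst _ hlt
    rw [if_pos (by simp), Equiv.apply_symm_apply] at hj'
    exact hj' hj
  · push Not at hexists
    simp [proportion, hexists]

end SwitchSucceeds

section Threshold

/-- The uniform distribution on `[0, 1]`. -/
noncomputable abbrev unif : Measure ℝ := volume.restrict (Set.Icc (0 : ℝ) 1)

instance : IsProbabilityMeasure unif := ⟨by simp⟩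

theorem real_unif_Iio {y : ℝ} (h0 : 0 ≤ y) (h1 : y ≤ 1) : unif.real (Set.Iio y) = y := by
  have hset : Set.Iio y ∩ Set.Icc 0 1 = Set.Ico 0 y := by
    ext t
    simp only [Set.mem_inter_iff, Set.mem_Iio, Set.mem_Icc, Set.mem_Ico]
    exact ⟨fun h => ⟨h.2.1, h.1⟩, fun h => ⟨h.2, h.1, h.2.le.trans h1⟩⟩
  rw [measureReal_restrict_apply measurableSet_Iio, hset, Real.volume_real_Ico_of_le h0, sub_zero]

/-- The pairs of a value and a random number that pass the threshold `θ`. A threshold is a pair of a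
value and a tie-breaking number: comparing the pairs lexicographically makes any two thresholds
comparable. -/
def aboveThreshold (θ : ℝ ×ₗ ℝ) : Set (ℝ × ℝ) := toLex ⁻¹' Set.Ici θ

theorem mem_aboveThreshold {θ : ℝ ×ₗ ℝ} {v : ℝ × ℝ} : v ∈ aboveThreshold θ ↔ θ ≤ toLex v := Iff.rfl

theorem aboveThreshold_antitone : Antitone aboveThreshold :=
  fun _ _ h => Set.preimage_mono (Set.Ici_subset_Ici.2 h)

theorem fst_le_of_mem_aboveThreshold {θ : ℝ ×ₗ ℝ} {v w : ℝ × ℝ} (hv : v ∈ aboveThreshold θ)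
    (hw : w ∉ aboveThreshold θ) : w.1 ≤ v.1 :=
  Prod.Lex.monotone_fst _ _ ((not_le.1 hw).le.trans hv)

theorem mem_aboveThreshold_toLex {τ y : ℝ} {v : ℝ × ℝ} :
    v ∈ aboveThreshold (toLex (τ, y)) ↔ τ < v.1 ∨ v.1 = τ ∧ y ≤ v.2 := by
  rw [mem_aboveThreshold, Prod.Lex.toLex_le_toLex, eq_comm]

theorem measurableSet_aboveThreshold (θ : ℝ ×ₗ ℝ) : MeasurableSet (aboveThreshold θ) := by
  obtain ⟨⟨τ, y⟩, rfl⟩ := toLex.surjective θ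
  have hset : aboveThreshold (toLex (τ, y)) = {v | τ < v.1} ∪ {v | v.1 = τ} ∩ {v | y ≤ v.2} :=
    Set.ext fun v => mem_aboveThreshold_toLex
  rw [hset]
  exact (measurableSet_lt measurable_const measurable_fst).union
    ((measurableSet_eq_fun measurable_fst measurable_const).inter
      (measurableSet_le measurable_const measurable_snd))

theorem real_compl_aboveThreshold (μ : Measure ℝ) [IsProbabilityMeasure μ] (τ : ℝ) {y : ℝ}
    (h0 : 0 ≤ y) (h1 : y ≤ 1) :
    (μ.prod unif).real (aboveThreshold (toLex (τ, y)))ᶜ = μ.real (Set.Iio τ) + y * μ.real {τ} := by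
  have hset : (aboveThreshold (toLex (τ, y)))ᶜ =
      Set.Iio τ ×ˢ Set.univ ∪ {τ} ×ˢ Set.Iio y := by
    ext v
    rw [Set.mem_compl_iff, mem_aboveThreshold, not_le, Prod.Lex.toLex_lt_toLex]
    simp
  have hdisj : Disjoint (Set.Iio τ ×ˢ Set.univ) ({τ} ×ˢ Set.Iio y) :=
    Set.disjoint_prod.2 (Or.inl (by simp))
  rw [hset, measureReal_union hdisj ((measurableSet_singleton τ).prod measurableSet_Iio),
    measureReal_prod_prod, measureReal_prod_prod, real_unif_Iio h0 h1, probReal_univ, mul_one,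
    mul_comm y]

theorem exists_real_Iio_le_le_real_Iic (μ : Measure ℝ) [IsProbabilityMeasure μ] {c : ℝ}
    (h0 : 0 < c) (h1 : c < 1) : ∃ τ, μ.real (Set.Iio τ) ≤ c ∧ c ≤ μ.real (Set.Iic τ) := by
  set E : Set ℝ := {t | c ≤ cdf μ t}
  obtain ⟨t₁, ht₁⟩ := ((tendsto_cdf_atTop μ).eventually_const_lt h1).exists
  obtain ⟨t₀, ht₀⟩ := ((tendsto_cdf_atBot μ).eventually_lt_const h0).exists
  have hne : E.Nonempty := ⟨t₁, ht₁.le⟩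
  have hbdd : BddBelow E := ⟨t₀, fun t (ht : c ≤ cdf μ t) => by
    by_contra! hlt
    exact (ht₀.trans_le ht).not_ge (monotone_cdf μ hlt.le)⟩
  have hleft : Function.leftLim (cdf μ) (sInf E) ≤ c := by
    refine le_of_tendsto ((monotone_cdf μ).tendsto_leftLim _) ?_
    filter_upwards [self_mem_nhdsWithin] with t ht
    by_contra! hlt
    exact (csInf_le hbdd hlt.le).not_gt ht
  have hright : c ≤ cdf μ (sInf E) := by
    refine ge_of_tendsto (((cdf μ).right_continuous _).mono_left
      (nhdsWithin_mono _ Set.Ioi_subset_Ici_self)) ?_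
    filter_upwards [self_mem_nhdsWithin] with t ht
    obtain ⟨s, hs, hst⟩ := exists_lt_of_csInf_lt hne ht
    exact hs.trans (monotone_cdf μ hst.le)
  refine ⟨sInf E, ?_, by rwa [← cdf_eq_real]⟩
  have hIio := (cdf μ).measure_Iio (tendsto_cdf_atBot μ) (sInf E)
  rw [measure_cdf, sub_zero] at hIio
  rw [measureReal_def, hIio]
  exact ENNReal.toReal_le_of_le_ofReal h0.le (ENNReal.ofReal_le_ofReal hleft)

theorem measureReal_pi_pi {ι X : Type*} [Fintype ι] [MeasurableSpace X] (μ : ι → Measure X)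
    [∀ i, SigmaFinite (μ i)] (s : ι → Set X) :
    (Measure.pi μ).real (Set.univ.pi s) = ∏ i, (μ i).real (s i) := by
  simp only [measureReal_def, Measure.pi_pi, ENNReal.toReal_prod]

theorem exists_prod_real_Iio_le_le_prod_real_Iic {ι : Type*} [Fintype ι] [Nonempty ι]
    (D : ι → Measure ℝ) [∀ i, IsProbabilityMeasure (D i)] {c : ℝ} (h0 : 0 < c) (h1 : c < 1) :
    ∃ τ, ∏ i, (D i).real (Set.Iio τ) ≤ c ∧ c ≤ ∏ i, (D i).real (Set.Iic τ) := by
  let maxValue (x : ι → ℝ) : ℝ := univ.sup' univ_nonempty x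
  have hmeas : Measurable maxValue := by
    have := Finset.measurable_sup' (f := fun (i : ι) (x : ι → ℝ) => x i) univ_nonempty
      fun i _ => measurable_pi_apply i
    convert this using 1
    ext x
    simp [maxValue]
  have hIio (τ : ℝ) : ((Measure.pi D).map maxValue).real (Set.Iio τ) =
      ∏ i, (D i).real (Set.Iio τ) := by
    rw [map_measureReal_apply hmeas measurableSet_Iio, ← measureReal_pi_pi]
    congr 1
    ext x
    simp [maxValue]
  have hIic (τ : ℝ) : ((Measure.pi D).map maxValue).real (Set.Iic τ) =
      ∏ i, (D i).real (Set.Iic τ) := by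
    rw [map_measureReal_apply hmeas measurableSet_Iic, ← measureReal_pi_pi]
    congr 1
    ext x
    simp [maxValue, Pi.le_def]
  have := Measure.isProbabilityMeasure_map (μ := Measure.pi D) hmeas.aemeasurable
  simpa only [hIio, hIic] using exists_real_Iio_le_le_real_Iic ((Measure.pi D).map maxValue) h0 h1

theorem exists_prod_real_compl_aboveThreshold_eq {ι : Type*} [Fintype ι] [Nonempty ι]
    (D : ι → Measure ℝ) [∀ i, IsProbabilityMeasure (D i)] {c : ℝ} (h0 : 0 < c) (h1 : c < 1) :
    ∃ θ, ∏ i, ((D i).prod unif).real (aboveThreshold θ)ᶜ = c := by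
  obtain ⟨τ, hIio, hIic⟩ := exists_prod_real_Iio_le_le_prod_real_Iic D h0 h1
  have hatom (i : ι) : (D i).real (Set.Iio τ) + (D i).real {τ} = (D i).real (Set.Iic τ) := by
    rw [← measureReal_union (by simp) (measurableSet_singleton τ), Set.Iio_union_right]
  obtain ⟨y, hy, hyc⟩ : c ∈
      (fun y : ℝ => ∏ i, ((D i).real (Set.Iio τ) + y * (D i).real {τ})) '' Set.Icc 0 1 :=
    intermediate_value_Icc zero_le_one (by fun_prop) ⟨by simpa using hIio, by simpa [hatom]⟩
  refine ⟨toLex (τ, y), ?_⟩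
  simpa only [real_compl_aboveThreshold _ τ hy.1 hy.2] using hyc

theorem exists_thresholds_prod_real_compl_eq {ι : Type*} [Fintype ι] [Nonempty ι]
    (D : ι → Measure ℝ) [∀ i, IsProbabilityMeasure (D i)] {lam mu : ℝ} (h0 : 0 < lam)
    (h : lam < mu) :
    ∃ θ θ', θ' ≤ θ ∧ ∏ i, ((D i).prod unif).real (aboveThreshold θ)ᶜ = Real.exp (-lam) ∧
      ∏ i, ((D i).prod unif).real (aboveThreshold θ')ᶜ = Real.exp (-mu) := by
  obtain ⟨θ, hθ⟩ := exists_prod_real_compl_aboveThreshold_eq D (Real.exp_pos (-lam))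
    (Real.exp_lt_one_iff.2 (by linarith))
  obtain ⟨θ', hθ'⟩ := exists_prod_real_compl_aboveThreshold_eq D (Real.exp_pos (-mu))
    (Real.exp_lt_one_iff.2 (by linarith))
  refine ⟨θ, θ', le_of_not_ge fun hge => ?_, hθ, hθ'⟩
  have hle : Real.exp (-lam) ≤ Real.exp (-mu) := by
    rw [← hθ, ← hθ']
    exact prod_le_prod (fun _ _ => measureReal_nonneg) fun i _ =>
      measureReal_mono (Set.compl_subset_compl.2 (aboveThreshold_antitone hge))
  linarith [Real.exp_le_exp.1 hle]

end Threshold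

section RandomHits

theorem sub_le_sum_div_sub_one {ι : Type*} [Fintype ι] {a b : ι → ℝ} (ha : ∀ i, 0 ≤ a i)
    (hb : ∀ i, 0 ≤ b i) {lam mu : ℝ} (hlam : ∏ i, a i = Real.exp (-lam))
    (hmu : ∏ i, b i = Real.exp (-mu)) : mu - lam ≤ ∑ i, (a i / b i - 1) := by
  have ha0 (i : ι) : a i ≠ 0 := prod_ne_zero_iff.1 (hlam ▸ (Real.exp_pos _).ne') i (mem_univ i)
  have hb0 (i : ι) : b i ≠ 0 := prod_ne_zero_iff.1 (hmu ▸ (Real.exp_pos _).ne') i (mem_univ i)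
  calc mu - lam = ∑ i, Real.log (a i / b i) := by
        simp only [fun i => Real.log_div (ha0 i) (hb0 i), sum_sub_distrib]
        rw [← Real.log_prod fun i _ => ha0 i, ← Real.log_prod fun i _ => hb0 i, hlam, hmu,
          Real.log_exp, Real.log_exp]
        ring
    _ ≤ ∑ i, (a i / b i - 1) := sum_le_sum fun i _ => Real.log_le_sub_one_of_pos <|
        div_pos ((ha i).lt_of_ne' (ha0 i)) ((hb i).lt_of_ne' (hb0 i))

variable {ι X : Type*} [Fintype ι]

open scoped Classical in
/-- The indices of the points of the family `w` that lie in `B`. -/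
noncomputable def hits (B : Set X) (w : ι → X) : Finset ι :=
  {i | w i ∈ B}

@[simp]
theorem mem_hits {B : Set X} {w : ι → X} {i : ι} : i ∈ hits B w ↔ w i ∈ B := by
  simp [hits]

theorem hits_mono {B B' : Set X} (h : B ⊆ B') (w : ι → X) : hits B w ⊆ hits B' w :=
  fun i hi => by simpa using h (by simpa using hi)

theorem comp_hits_eq_sum_indicator (B : Set X) (f : Finset ι → ℝ) (w : ι → X) :
    f (hits B w) = ∑ T, {w | hits B w = T}.indicator (fun _ => f T) w := by
  classical
  simp [Set.indicator_apply]

/-- The event that no point of a family lies in `B` and exactly one lies in `B'`. When `B` and `B'`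
are given by a high and a low threshold, lowering the threshold pays off on this event. -/
def soleHit (ι : Type*) [Fintype ι] (B B' : Set X) : Set (ι → X) :=
  {w | hits B w = ∅ ∧ #(hits B' w) = 1}

theorem soleHit_eq_iUnion (B B' : Set X) :
    soleHit ι B B' = ⋃ j, {w | hits B w = ∅ ∧ hits B' w = {j}} := by
  ext w
  simp [soleHit, card_eq_one]

theorem setOf_hits_eq [DecidableEq ι] (B : Set X) (T : Finset ι) :
    {w : ι → X | hits B w = T} = Set.univ.pi fun i => if i ∈ T then B else Bᶜ := by
  ext w
  simp only [Set.mem_ofPred_eq, Finset.ext_iff, mem_hits, Set.mem_univ_pi]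
  refine forall_congr' fun i => ?_
  split_ifs with hi <;> simp [hi]

theorem setOf_hits_eq_empty_and_eq_singleton [DecidableEq ι] {B B' : Set X} (h : B ⊆ B') (j : ι) :
    {w : ι → X | hits B w = ∅ ∧ hits B' w = {j}} =
      Set.univ.pi fun i => if i = j then B' \ B else B'ᶜ := by
  ext w
  simp only [Set.mem_ofPred_eq, Finset.ext_iff, mem_hits, Set.mem_univ_pi, ← forall_and]
  refine forall_congr' fun i => ?_
  split_ifs with hi
  · simp [hi, and_comm]
  · simpa [hi] using mt (@h (w i))

variable [MeasurableSpace X] (μ : ι → Measure X) [∀ i, IsProbabilityMeasure (μ i)]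
  {B B' : Set X}

theorem measurableSet_hits_eq (hB : MeasurableSet B) (T : Finset ι) :
    MeasurableSet {w : ι → X | hits B w = T} := by
  classical
  rw [setOf_hits_eq]
  refine MeasurableSet.univ_pi fun i => ?_
  split_ifs
  exacts [hB, hB.compl]

theorem measureReal_hits_eq [DecidableEq ι] (hB : MeasurableSet B) (T : Finset ι) :
    (Measure.pi μ).real {w | hits B w = T} = inclusionProb (fun i => (μ i).real B) T := by
  rw [setOf_hits_eq, measureReal_pi_pi, inclusionProb, ← prod_mul_prod_compl T]
  congr 1
  · exact prod_congr rfl fun i hi => by rw [if_pos hi]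
  · exact prod_congr rfl fun i hi => by
      rw [if_neg (mem_compl.1 hi), probReal_compl_eq_one_sub hB]

theorem integrable_comp_hits (hB : MeasurableSet B) (f : Finset ι → ℝ) :
    Integrable (fun w => f (hits B w)) (Measure.pi μ) := by
  simp only [comp_hits_eq_sum_indicator]
  exact integrable_finsetSum _ fun T _ =>
    (integrable_const _).indicator (measurableSet_hits_eq hB T)

theorem integral_comp_hits [DecidableEq ι] (hB : MeasurableSet B) (f : Finset ι → ℝ) :
    ∫ w, f (hits B w) ∂Measure.pi μ = ∑ T, inclusionProb (fun i => (μ i).real B) T * f T := by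
  simp only [comp_hits_eq_sum_indicator B f]
  rw [integral_finsetSum _ fun T _ =>
    (integrable_const _).indicator (measurableSet_hits_eq hB T)]
  refine sum_congr rfl fun T _ => ?_
  rw [integral_indicator_const _ (measurableSet_hits_eq hB T), measureReal_hits_eq μ hB,
    smul_eq_mul]

theorem integral_card_hits (hB : MeasurableSet B) :
    ∫ w, (#(hits B w) : ℝ) ∂Measure.pi μ = ∑ i, (μ i).real B := by
  have hind (i : ι) : Integrable (B.indicator (1 : X → ℝ)) (μ i) :=
    (integrable_const 1).indicator hB
  have hcard (w : ι → X) : (#(hits B w) : ℝ) = ∑ i, B.indicator 1 (w i) := by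
    classical
    simp only [hits, natCast_card_filter, Set.indicator_apply, Pi.one_apply]
  simp only [hcard]
  rw [integral_finsetSum _ fun i _ => integrable_comp_eval (hind i)]
  refine sum_congr rfl fun i _ => ?_
  rw [integral_comp_eval (hind i).aestronglyMeasurable, integral_indicator_one hB]

theorem integral_card_hits_le (hB : MeasurableSet B) {mu : ℝ}
    (hmu : ∏ i, (μ i).real Bᶜ = Real.exp (-mu)) :
    ∫ w, (#(hits B w) : ℝ) ∂Measure.pi μ ≤ mu := by
  have h := sub_le_sum_div_sub_one (b := fun _ => 1) (mu := 0) (fun _ => measureReal_nonneg)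
    (fun _ => zero_le_one) hmu (by simp)
  simp only [div_one, probReal_compl_eq_one_sub hB, sub_sub_cancel_left, sum_neg_distrib] at h
  rw [integral_card_hits μ hB]
  linarith

theorem measureReal_hits_eq_empty_and_eq_singleton (hB : MeasurableSet B) (hB' : MeasurableSet B')
    (h : B ⊆ B') {j : ι} (hj : (μ j).real B'ᶜ ≠ 0) :
    (Measure.pi μ).real {w | hits B w = ∅ ∧ hits B' w = {j}} =
      ((μ j).real Bᶜ / (μ j).real B'ᶜ - 1) * ∏ i, (μ i).real B'ᶜ := by
  classical
  have hdiff : (μ j).real (B' \ B) = (μ j).real Bᶜ - (μ j).real B'ᶜ := by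
    rw [measureReal_sdiff h hB, probReal_compl_eq_one_sub hB, probReal_compl_eq_one_sub hB']
    ring
  rw [setOf_hits_eq_empty_and_eq_singleton h, measureReal_pi_pi,
    ← mul_prod_erase univ _ (mem_univ j), ← mul_prod_erase univ _ (mem_univ j), if_pos rfl, hdiff,
    prod_congr rfl fun i hi => by rw [if_neg (ne_of_mem_erase hi)]]
  field_simp

theorem measurableSet_soleHit (hB : MeasurableSet B) (hB' : MeasurableSet B') :
    MeasurableSet (soleHit ι B B') := by
  rw [soleHit_eq_iUnion]
  exact MeasurableSet.iUnion fun j =>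
    (measurableSet_hits_eq hB ∅).inter (measurableSet_hits_eq hB' {j})

theorem le_measureReal_soleHit (hB : MeasurableSet B)
    (hB' : MeasurableSet B') (h : B ⊆ B') {lam mu : ℝ}
    (hlam : ∏ i, (μ i).real Bᶜ = Real.exp (-lam)) (hmu : ∏ i, (μ i).real B'ᶜ = Real.exp (-mu)) :
    (mu - lam) * Real.exp (-mu) ≤ (Measure.pi μ).real (soleHit ι B B') := by
  have hdisj : Pairwise (Function.onFun Disjoint
      fun j => {w : ι → X | hits B w = ∅ ∧ hits B' w = {j}}) := fun i j hij =>
    Set.disjoint_left.2 fun w hi hj => hij (singleton_injective (hi.2.symm.trans hj.2))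
  have hne (j : ι) : (μ j).real B'ᶜ ≠ 0 :=
    prod_ne_zero_iff.1 (hmu ▸ (Real.exp_pos _).ne') j (mem_univ j)
  rw [soleHit_eq_iUnion, measureReal_iUnion_fintype hdisj fun j =>
    (measurableSet_hits_eq hB ∅).inter (measurableSet_hits_eq hB' {j})]
  simp only [fun j => measureReal_hits_eq_empty_and_eq_singleton μ hB hB' h (hne j), ← sum_mul, hmu]
  gcongr
  exact sub_le_sum_div_sub_one (fun _ => measureReal_nonneg) (fun _ => measureReal_nonneg) hlam hmu

end RandomHits

section SuccessProbability

variable {n m : ℕ}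

/-- The values of the items, together with the random numbers in the order `π` in which the items
arrive. -/
def byStep (π : Equiv.Perm (Fin n)) (w : Fin n → ℝ × ℝ) : (Fin n → ℝ) × (Fin n → ℝ) :=
  (fun i => (w i).1, fun k => (w (π k)).2)

/-- The joint law of the pairs of an item's value and random number. The random numbers are attached
to the items, whereas `law` attaches them to the steps: this does not change the success
probability, and it makes the set of items above a threshold independent of the order. -/
noncomputable def pairLaw (D : Fin n → Measure ℝ) : Measure (Fin n → ℝ × ℝ) :=
  Measure.pi fun i => (D i).prod unif

instance (D : Fin n → Measure ℝ) [∀ i, IsProbabilityMeasure (D i)] :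
    IsProbabilityMeasure (pairLaw D) := by
  unfold pairLaw
  infer_instance

theorem measurePreserving_byStep (D : Fin n → Measure ℝ) [∀ i, IsProbabilityMeasure (D i)]
    (π : Equiv.Perm (Fin n)) :
    MeasurePreserving (byStep π) (pairLaw D) (law D) := by
  have hunzip := measurePreserving_arrowProdEquivProdArrow ℝ ℝ (Fin n) D fun _ => unif
  have hperm := measurePreserving_piCongrLeft (fun _ : Fin n => unif) π.symm
  unfold pairLaw law
  convert ((MeasurePreserving.id (Measure.pi D)).prod hperm).comp hunzip using 1
  funext w
  refine Prod.ext rfl (funext fun k => ?_)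
  have h := MeasurableEquiv.piCongrLeft_apply_apply π.symm (β := fun _ => ℝ) (fun i => (w i).2)
    (π k)
  rw [Equiv.symm_apply_apply] at h
  exact h.symm

theorem measurable_byStep (π : Equiv.Perm (Fin n)) : Measurable (byStep π) := by
  unfold byStep
  fun_prop

theorem measurable_history (π : Equiv.Perm (Fin n)) (k : Fin n) :
    Measurable fun xy : (Fin n → ℝ) × (Fin n → ℝ) => history π xy.1 xy.2 k := by
  unfold history
  fun_prop

theorem measurableSet_succeeds (A : OnlineAlg n) (π : Equiv.Perm (Fin n)) :
    MeasurableSet {xy : (Fin n → ℝ) × (Fin n → ℝ) | A.Succeeds π xy.1 xy.2} := by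
  have haccept (k : Fin n) : MeasurableSet
      {xy : (Fin n → ℝ) × (Fin n → ℝ) | history π xy.1 xy.2 k ∈ A.accept k} :=
    measurable_history π k (A.measurableSet_accept k)
  have hset : {xy : (Fin n → ℝ) × (Fin n → ℝ) | A.Succeeds π xy.1 xy.2} =
      ⋃ k, (({xy | history π xy.1 xy.2 k ∈ A.accept k} ∩
        ⋂ j, ⋂ _ : j < k, {xy | history π xy.1 xy.2 j ∈ A.accept j}ᶜ) ∩
        ⋂ i, {xy | xy.1 i ≤ xy.1 (π k)}) := by
    ext xy
    simp [OnlineAlg.Succeeds, OnlineAlg.StopsAt]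
  rw [hset]
  refine MeasurableSet.iUnion fun k => ((haccept k).inter ?_).inter ?_
  · exact MeasurableSet.iInter fun j => MeasurableSet.iInter fun _ => (haccept j).compl
  · exact MeasurableSet.iInter fun i => measurableSet_le (by fun_prop) (by fun_prop)

/-- The fraction of the orders in which `A` succeeds, for given values and random numbers of the
items. -/
noncomputable def successFraction (A : OnlineAlg n) (w : Fin n → ℝ × ℝ) : ℝ :=
  proportion fun π => A.Succeeds π (byStep π w).1 (byStep π w).2

theorem successFraction_eq_sum_indicator (A : OnlineAlg n) (w : Fin n → ℝ × ℝ) :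
    successFraction A w = (∑ π : Equiv.Perm (Fin n),
      (byStep π ⁻¹' {xy | A.Succeeds π xy.1 xy.2}).indicator (fun _ => (1 : ℝ)) w) / n ! := by
  classical
  rw [successFraction, proportion, natCast_card_filter, Fintype.card_perm, Fintype.card_fin]
  simp [Set.indicator_apply]

theorem measurableSet_preimage_byStep_succeeds (A : OnlineAlg n) (π : Equiv.Perm (Fin n)) :
    MeasurableSet (byStep π ⁻¹' {xy | A.Succeeds π xy.1 xy.2}) :=
  measurable_byStep π (measurableSet_succeeds A π)

variable (D : Fin n → Measure ℝ) [∀ i, IsProbabilityMeasure (D i)]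

theorem integrable_successFraction (A : OnlineAlg n) :
    Integrable (successFraction A) (pairLaw D) := by
  simp only [funext (successFraction_eq_sum_indicator A)]
  exact (integrable_finsetSum _ fun π _ =>
    (integrable_const 1).indicator (measurableSet_preimage_byStep_succeeds A π)).div_const _

theorem integral_successFraction (A : OnlineAlg n) :
    ∫ w, successFraction A w ∂pairLaw D = successProb D A := by
  have hmeas := measurableSet_preimage_byStep_succeeds A
  simp only [successFraction_eq_sum_indicator]
  rw [integral_div, integral_finsetSum _ fun π _ => (integrable_const 1).indicator (hmeas π),
    successProb]
  congr 1
  refine sum_congr rfl fun π _ => ?_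
  rw [integral_indicator_const _ (hmeas π), smul_eq_mul, mul_one]
  exact (measurePreserving_byStep D π).measureReal_preimage
    (measurableSet_succeeds A π).nullMeasurableSet

end SuccessProbability

section SwitchAlgorithm

variable {n m : ℕ} {θ θ' : ℝ ×ₗ ℝ}

/-- The algorithm with threshold `θ` for the first `n - m` steps and `θ'` for the last `m`. -/
def switchAlg (n m : ℕ) (θ θ' : ℝ ×ₗ ℝ) : OnlineAlg n where
  accept k := {h | (h (Fin.last k)).2 ∈ aboveThreshold (if (k : ℕ) + m < n then θ else θ')}
  measurableSet_accept k := by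
    have hlast : Measurable fun h : Fin ((k : ℕ) + 1) → Obs n => (h (Fin.last k)).2 := by fun_prop
    exact hlast (measurableSet_aboveThreshold _)

theorem singleThreshold_eq_switchAlg (n : ℕ) (τ ybar : ℝ) (θ' : ℝ ×ₗ ℝ) :
    singleThreshold n τ ybar = switchAlg n 0 (toLex (τ, ybar)) θ' := by
  unfold singleThreshold switchAlg
  congr 1
  funext k
  simp [mem_aboveThreshold_toLex]

theorem switchAlg_succeeds_iff (w : Fin n → ℝ × ℝ) (π : Equiv.Perm (Fin n)) :
    (switchAlg n m θ θ').Succeeds π (byStep π w).1 (byStep π w).2 ↔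
      SwitchSucceeds m (hits (aboveThreshold θ) w) (hits (aboveThreshold θ') w)
        (fun i => (w i).1) π := by
  have haccept (k : Fin n) : history π (byStep π w).1 (byStep π w).2 k ∈
      (switchAlg n m θ θ').accept k ↔
      π k ∈ if (k : ℕ) + m < n then hits (aboveThreshold θ) w else hits (aboveThreshold θ') w := by
    change w (π k) ∈ aboveThreshold (if (k : ℕ) + m < n then θ else θ') ↔ _
    split_ifs <;> rw [mem_hits]
  simp only [OnlineAlg.Succeeds, OnlineAlg.StopsAt, haccept, SwitchSucceeds]
  rfl

theorem successFraction_switchAlg (w : Fin n → ℝ × ℝ) :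
    successFraction (switchAlg n m θ θ') w = proportion
      (SwitchSucceeds m (hits (aboveThreshold θ) w) (hits (aboveThreshold θ') w)
        fun i => (w i).1) := by
  simp only [successFraction, switchAlg_succeeds_iff]

theorem fst_le_of_mem_hits_of_notMem_hits {w : Fin n → ℝ × ℝ} {i j : Fin n}
    (hi : i ∈ hits (aboveThreshold θ) w) (hj : j ∉ hits (aboveThreshold θ) w) :
    (w j).1 ≤ (w i).1 :=
  fst_le_of_mem_aboveThreshold (mem_hits.1 hi) (mt mem_hits.2 hj)

theorem le_successFraction_switchAlg (hm : m ≤ n) (hθ : θ' ≤ θ) (w : Fin n → ℝ × ℝ) :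
    1 / (#(hits (aboveThreshold θ) w) : ℝ)
        - m / n * ((m - 1) / (n - 1)) * #(hits (aboveThreshold θ') w)
        + (soleHit (Fin n) (aboveThreshold θ) (aboveThreshold θ')).indicator
            (fun _ => (m / n : ℝ)) w
      ≤ successFraction (switchAlg n m θ θ') w := by
  rw [successFraction_switchAlg]
  by_cases hsole : w ∈ soleHit (Fin n) (aboveThreshold θ) (aboveThreshold θ')
  · obtain ⟨i, hi⟩ := card_eq_one.1 hsole.2
    have hmax (j : Fin n) : (w j).1 ≤ (w i).1 := by
      rcases eq_or_ne j i with rfl | hj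
      · rfl
      · exact fst_le_of_mem_hits_of_notMem_hits (θ := θ') (by simp [hi]) (by simpa [hi] using hj)
    rw [Set.indicator_of_mem hsole, hsole.1, hi]
    refine le_trans ?_ (div_le_proportion_switchSucceeds_singleton hm hmax)
    simpa using bothLate_nonneg hm
  · rw [Set.indicator_of_notMem hsole, add_zero]
    exact sub_le_proportion_switchSucceeds hm (hits_mono (aboveThreshold_antitone hθ) w)
      fun i hi j hj => fst_le_of_mem_hits_of_notMem_hits hi hj

variable (D : Fin n → Measure ℝ) [∀ i, IsProbabilityMeasure (D i)]

theorem le_successProb_switchAlg (hm : m ≤ n) (hθ : θ' ≤ θ) {lam mu : ℝ}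
    (hlam : ∏ i, ((D i).prod unif).real (aboveThreshold θ)ᶜ = Real.exp (-lam))
    (hmu : ∏ i, ((D i).prod unif).real (aboveThreshold θ')ᶜ = Real.exp (-mu)) :
    poissonSum lam - m / n * ((m - 1) / (n - 1)) * mu + m / n * ((mu - lam) * Real.exp (-mu)) ≤
      successProb D (switchAlg n m θ θ') := by
  have hB := measurableSet_aboveThreshold θ
  have hB' := measurableSet_aboveThreshold θ'
  have hinv : Integrable (fun w => 1 / (#(hits (aboveThreshold θ) w) : ℝ)) (pairLaw D) :=
    integrable_comp_hits _ hB fun T => 1 / (#T : ℝ)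
  have hcard : Integrable (fun w => m / n * ((m - 1) / (n - 1)) *
      (#(hits (aboveThreshold θ') w) : ℝ)) (pairLaw D) :=
    (integrable_comp_hits _ hB' fun T => (#T : ℝ)).const_mul _
  have hsole := measurableSet_soleHit (ι := Fin n) hB hB'
  have hind : Integrable ((soleHit (Fin n) (aboveThreshold θ) (aboveThreshold θ')).indicator
      fun _ => (m / n : ℝ)) (pairLaw D) := (integrable_const _).indicator hsole
  have hinv_eq : ∫ w, 1 / (#(hits (aboveThreshold θ) w) : ℝ) ∂pairLaw D =
      meanInvCard fun i => ((D i).prod unif).real (aboveThreshold θ) :=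
    integral_comp_hits _ hB fun T => 1 / (#T : ℝ)
  rw [← integral_successFraction]
  refine le_trans ?_ (integral_mono ((hinv.sub hcard).add hind)
    (integrable_successFraction D _) (le_successFraction_switchAlg hm hθ))
  rw [integral_add' (hinv.sub hcard) hind, integral_sub' hinv hcard, integral_const_mul,
    integral_indicator_const _ hsole, smul_eq_mul, mul_comm _ (m / n : ℝ), hinv_eq]
  gcongr ?_ - _ * ?_ + _ * ?_
  · refine poissonSum_le_meanInvCard (fun i => measureReal_le_one) ?_
    simp only [← hlam, probReal_compl_eq_one_sub hB]
  · exact bothLate_nonneg hm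
  · exact integral_card_hits_le _ hB' hmu
  · exact le_measureReal_soleHit _ hB hB' (aboveThreshold_antitone hθ) hlam hmu

theorem exists_switch_window {n : ℕ} (hn : 1 ≤ n) {δ : ℝ} (h0 : 0 < δ) (h1 : δ ≤ 1) :
    ∃ m ≤ n, δ ≤ m / n ∧ ((m : ℝ) - 1) / (n - 1) ≤ 2 * δ := by
  have hn0 : (0 : ℝ) < n := by exact_mod_cast hn
  refine ⟨⌈δ * n⌉₊, Nat.ceil_le.2 (mul_le_of_le_one_left hn0.le h1), ?_, ?_⟩
  · rw [le_div_iff₀ hn0]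
    exact Nat.le_ceil _
  · rcases hn.eq_or_lt with rfl | hn2
    · simpa using h0.le
    · have hn2' : (2 : ℝ) ≤ n := by exact_mod_cast hn2
      rw [div_le_iff₀ (by linarith)]
      have := Nat.ceil_lt_add_one (a := δ * n) (by positivity)
      nlinarith

theorem exists_forall_add_le_successProb {lam : ℝ} (hlam : 0 < lam) :
    ∃ ε : ℝ, 0 < ε ∧ ∀ (n : ℕ) (D : Fin n → Measure ℝ), 1 ≤ n →
      (∀ i, IsProbabilityMeasure (D i)) → ∃ A : OnlineAlg n,
        poissonSum lam + ε ≤ successProb D A := by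
  set mu := lam + 1 with hmu
  set κ := Real.exp (-mu)
  set δ := κ / (4 * mu) with hδ
  have hκ1 : κ < 1 := Real.exp_lt_one_iff.2 (by linarith)
  have hmu0 : 0 < mu := by positivity
  have hδmu : 2 * δ * mu = κ / 2 := by
    rw [hδ]
    field_simp
    ring
  have hδ1 : δ ≤ 1 := by
    rw [hδ, div_le_one (by positivity)]
    linarith
  refine ⟨δ * (κ / 2), by positivity, fun n D hn hD => ?_⟩
  have : Nonempty (Fin n) := Fin.pos_iff_nonempty.1 hn
  obtain ⟨m, hm, hm1, hm2⟩ := exists_switch_window hn (δ := δ) (by positivity) hδ1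
  obtain ⟨θ, θ', hθ, h, h'⟩ := exists_thresholds_prod_real_compl_eq D hlam (lt_add_one lam)
  refine ⟨switchAlg n m θ θ', le_trans ?_ (le_successProb_switchAlg D hm hθ h h')⟩
  calc poissonSum lam + δ * (κ / 2) ≤ poissonSum lam + m / n * (κ / 2) := by gcongr
    _ = poissonSum lam - m / n * (2 * δ) * mu + m / n * ((mu - lam) * κ) := by
        rw [mul_assoc, hδmu, hmu]
        ring
    _ ≤ _ := by gcongr

end SwitchAlgorithm

section SingleThreshold

theorem prod_diagonal_eq_zero {X : Type*} [MeasurableSpace X] [MeasurableEq X]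
    (μ ν : Measure X) [SFinite ν] [NullSingletonClass ν] : μ.prod ν (Set.diagonal X) = 0 := by
  rw [Measure.measure_prod_null measurableSet_diagonal]
  refine ae_of_all _ fun x => ?_
  have : Prod.mk x ⁻¹' Set.diagonal X = {x} := by
    ext
    simp [eq_comm]
  simp [this]

theorem ae_injective_pi {ι X : Type*} [Fintype ι] [MeasurableSpace X] [MeasurableEq X]
    (μ : ι → Measure X) [∀ i, IsProbabilityMeasure (μ i)] [∀ i, NullSingletonClass (μ i)] :
    ∀ᵐ x ∂Measure.pi μ, Function.Injective x := by
  have hne (i j : ι) (hij : i ≠ j) : ∀ᵐ x ∂Measure.pi μ, x i ≠ x j := by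
    have hmap : (Measure.pi μ).map (fun x => (x i, x j)) = (μ i).prod (μ j) := by
      have hindep : IndepFun (Function.eval i) (Function.eval j) (Measure.pi μ) :=
        (iIndepFun_pi (X := fun _ => id) fun _ => aemeasurable_id).indepFun hij
      have h := (indepFun_iff_map_prod_eq_prod_map_map (measurable_pi_apply i).aemeasurable
        (measurable_pi_apply j).aemeasurable).1 hindep
      rwa [(measurePreserving_eval μ i).map_eq, (measurePreserving_eval μ j).map_eq] at h
    have h := prod_diagonal_eq_zero (μ i) (μ j)
    rw [← hmap, Measure.map_apply (by fun_prop) measurableSet_diagonal] at h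
    exact measure_eq_zero_iff_ae_notMem.1 h
  simp only [Function.Injective, ae_all_iff]
  intro i j
  by_cases hij : i = j
  · simp [hij]
  · filter_upwards [hne i j hij] with x hx h using absurd h hx

instance : NullSingletonClass unif := by
  unfold unif
  infer_instance

theorem ae_injective_fst_pairLaw {n : ℕ} (D : Fin n → Measure ℝ) [∀ i, IsProbabilityMeasure (D i)]
    [∀ i, NullSingletonClass (D i)] : ∀ᵐ w ∂pairLaw D, Function.Injective fun i => (w i).1 :=
  (Measure.quasiMeasurePreserving_fst.comp
    (measurePreserving_byStep D 1).quasiMeasurePreserving).ae (ae_injective_pi D)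

theorem successProb_singleThreshold_le_meanInvCard {n : ℕ} (D : Fin n → Measure ℝ)
    [∀ i, IsProbabilityMeasure (D i)] [∀ i, NullSingletonClass (D i)] (τ ybar : ℝ) :
    successProb D (singleThreshold n τ ybar) ≤
      meanInvCard fun i => ((D i).prod unif).real (aboveThreshold (toLex (τ, ybar))) := by
  have hB := measurableSet_aboveThreshold (toLex (τ, ybar))
  rw [← integral_successFraction, meanInvCard, ← integral_comp_hits _ hB fun T => 1 / (#T : ℝ)]
  refine integral_mono_ae (integrable_successFraction D _)
    (integrable_comp_hits _ hB fun T => 1 / (#T : ℝ)) ?_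
  filter_upwards [ae_injective_fst_pairLaw D] with w hw
  rw [singleThreshold_eq_switchAlg n τ ybar (toLex (τ, ybar)), successFraction_switchAlg]
  exact proportion_switchSucceeds_zero_le hw

end SingleThreshold

end ProphetSecretary

theorem mainTheorem8 :
    ∃ M : ℝ, IsGreatest (ProphetSecretary.poissonSum '' Set.Ici 0) M ∧
      ∃ ε₀ : ℝ, 0 < ε₀ ∧
        (∀ (n : ℕ) (D : Fin n → Measure ℝ), 1 ≤ n → (∀ i, IsProbabilityMeasure (D i)) →
          ∃ A : ProphetSecretary.OnlineAlg n, M + ε₀ ≤ ProphetSecretary.successProb D A) ∧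
        (∀ δ : ℝ, 0 < δ →
          ∃ (n : ℕ) (D : Fin n → Measure ℝ), 1 ≤ n ∧ (∀ i, IsProbabilityMeasure (D i)) ∧
            ∀ τ ybar : ℝ,
              ProphetSecretary.successProb D (ProphetSecretary.singleThreshold n τ ybar)
                < M + δ) := by
  obtain ⟨lam, hlam, hmax⟩ := ProphetSecretary.exists_isMaxOn_poissonSum
  obtain ⟨ε, hε, halg⟩ := ProphetSecretary.exists_forall_add_le_successProb hlam
  refine ⟨ProphetSecretary.poissonSum lam,
    ⟨Set.mem_image_of_mem _ hlam.le, Set.forall_mem_image.2 hmax⟩, ε, hε, halg, fun δ hδ => ?_⟩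
  obtain ⟨n, hn, hlt⟩ := ProphetSecretary.exists_meanInvCard_const_lt
    (ProphetSecretary.poissonSum_pos hlam) hmax hδ
  exact ⟨n, fun _ => ProphetSecretary.unif, hn, fun _ => inferInstance, fun τ ybar =>
    (ProphetSecretary.successProb_singleThreshold_le_meanInvCard _ τ ybar).trans_lt
      (hlt _ measureReal_nonneg measureReal_le_one)⟩
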